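/- Let $N>0$ be an integer, let $\rho_1,\dots,\rho_N\in\,]-1,1[$, $\theta_1>0$, $a_2,\dots,a_N>0$ and $c_1,\dots,c_N\in\,]0,1[$. Let $\mathfrak f$ be either of the following two functions of $\theta>0$ and $r\in[0,1[$: $$\mathfrak f_{GJ}(\theta,r)=\frac{4\theta}{1+r},\qquad \mathfrak f_{MM}(\theta,r)=\inf_{l>l_2(r)}\frac{4\theta\sqrt{1-r^2}\,h(l,r)^2}{\theta\sqrt{1-r^2}\,g(l,r)^2-g_2(l,r)},$$ where $l_2(r)=1/\tan\bigl(\tfrac{\arccos(-r)}3\bigr)$, $\mathcal N(l,r)=\sqrt{1-r^2}+rl+\sqrt{l^2+1}$ and, with derivatives taken with respect to $l$, $$g=\frac{\mathcal N'}4,\qquad h=1-\Bigl(l-\frac r{\sqrt{1-r^2}}\Bigr)\frac{\mathcal N'}{2\mathcal N},\qquad g_2=\mathcal N''-\frac{(\mathcal N')^2}{2\mathcal N}.$$ Define $$p_i=\max\Bigl(\frac{1+\rho_{i-1}}{1+\rho_i},\frac{1-\rho_{i-1}}{1-\rho_i}\Bigr)\ (i>1),\qquad \theta_i=\theta_{i-1}p_i+a_i\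 (i>1),\qquad f_i=\min\Bigl(\frac4{1+|\rho_i|},\sqrt{\mathfrak f(\theta_i,|\rho_i|)}\Bigr)\ (i\ge1),$$ and then, successively for $i=1,\dots,N$, $\psi_i=c_i(C_{\psi_i}-A_{\psi_i})+A_{\psi_i}$, where $A_{\psi_1}=0$ and $C_{\psi_1}=\min\bigl(f_1,\frac{f_2}{p_2},\dots,\frac{f_N}{\prod_{j=2}^Np_j}\bigr)$, while for $i>1$ $$A_{\psi_i}=\psi_{i-1}p_i,\qquad C_{\psi_i}=\min\Bigl(\frac{\psi_{i-1}}{\theta_{i-1}}\theta_i,\,f_i,\,\frac{f_{i+1}}{p_{i+1}},\dots,\frac{f_N}{\prod_{j=i+1}^Np_j}\Bigr).$$ Let $0<T_1<\dots<T_N$ be maturities with discount factors $D_0(T_i)>0$ and forwards $F_0(T_i)>0$. For a strike $K>0$ let $k=\log\frac K{F_0(T_i)}$, let $$\mathrm{eSSVI}_i(K,T_i)=\tfrac12\Bigl(\theta_i+\rho_i\psi_ik+\sqrt{(\psi_ik+\theta_i\rho_i)^2+\theta_i^2(1-\rho_i^2)}\Bigr),\qquad \sigma=\sqrt{\mathrm{eSSVI}_i(K,T_i)/T_i},$$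 and let $C(K,T_i)=D_0(T_i)\bigl(F_0(T_i)\Phi(d_1)-K\Phi(d_2)\bigr)$ be the Black–Scholes Call price, where $\Phi$ is the standard normal distribution function, $d_1=\frac{\sigma\sqrt{T_i}}2-\frac k{\sigma\sqrt{T_i}}$ and $d_2=d_1-\sigma\sqrt{T_i}$. Then these prices are free of Butterfly and Calendar spread arbitrage, that is: 1. (no Butterfly arbitrage) for every $i\in\{1,\dots,N\}$ the function $K\mapsto C(K,T_i)$ is convex on $]0,\infty[$ and satisfies $D_0(T_i)(F_0(T_i)-K)^+\le C(K,T_i)\le D_0(T_i)F_0(T_i)$ for all $K>0$; 2. (no Calendar spread arbitrage) for all $1\le i<j\le N$ and every log-forward moneyness $k\in\mathbb R$, $$\frac{C(F_0(T_i)e^k,T_i)}{D_0(T_i)F_0(T_i)}\le\frac{C(F_0(T_j)e^k,T_j)}{D_0(T_j)F_0(T_j)}.$$ -/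

import Mathlib

open scoped BigOperators

namespace GlobalESSVI

noncomputable section

/-! ### Black-Scholes prices -/

/-- The cumulative distribution function of the standard normal law. -/
def Phi (x : ℝ) : ℝ := ProbabilityTheory.cdf (ProbabilityTheory.gaussianReal 0 1) x

/-- Black-Scholes price of a Call with strike `K` and maturity `T`, for the discount factor `D`,
the forward `F` and the (implied) volatility `σ`. -/
def bsCall (D F T K σ : ℝ) : ℝ :=
  let k := Real.log (K / F)
  let d₁ := σ * Real.sqrt T / 2 - k / (σ * Real.sqrt T)
  let d₂ := d₁ - σ * Real.sqrt T
  D * (F * Phi d₁ - K * Phi d₂)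

/-- The SSVI total implied variance at log-forward moneyness `k`, with parameters
`(θ, ρ, ψ)`. -/
def ssvi (θ ρ ψ k : ℝ) : ℝ :=
  (θ + ρ * ψ * k + Real.sqrt ((ψ * k + θ * ρ) ^ 2 + θ ^ 2 * (1 - ρ ^ 2))) / 2

/-- Implied volatility of an SSVI slice at strike `K` and maturity `T`. -/
def ssviVol (F T θ ρ ψ K : ℝ) : ℝ := Real.sqrt (ssvi θ ρ ψ (Real.log (K / F)) / T)

/-- Call price at strike `K` and maturity `T` obtained by injecting the SSVI implied volatility
in the Black-Scholes formula. -/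
def ssviCall (D F T θ ρ ψ K : ℝ) : ℝ := bsCall D F T K (ssviVol F T θ ρ ψ K)

/-! ### Absence of arbitrage -/

/-- Absence of Butterfly arbitrage for the Call prices `C` (as a function of the strike) of one
maturity with discount factor `D` and forward `F`: convexity in the strike, and bounds by the
discounted payoff evaluated at the forward and by the discounted forward. -/
def NoButterflyArbitrage (D F : ℝ) (C : ℝ → ℝ) : Prop :=
  ConvexOn ℝ (Set.Ioi 0) C ∧ ∀ K : ℝ, 0 < K → D * max (F - K) 0 ≤ C K ∧ C K ≤ D * F

/-- Absence of Calendar spread arbitrage between an earlier maturity (discount factor `D₁`,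
forward `F₁`, Call prices `C₁`) and a later one (`D₂`, `F₂`, `C₂`): at each fixed log-forward
moneyness `k`, i.e. for the strikes `F₁ * exp k` and `F₂ * exp k`, the Call price in units of the
discounted forward does not decrease. -/
def NoCalendarSpreadArbitrage (D₁ F₁ : ℝ) (C₁ : ℝ → ℝ) (D₂ F₂ : ℝ) (C₂ : ℝ → ℝ) : Prop :=
  ∀ k : ℝ, C₁ (F₁ * Real.exp k) / (D₁ * F₁) ≤ C₂ (F₂ * Real.exp k) / (D₂ * F₂)

/-! ### The two bounding functions for the squared `ψ` -/

/-- The Gatheral-Jacquier function; the second argument is the absolute correlation. -/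
def fGJ (θ ρ : ℝ) : ℝ := 4 * θ / (1 + ρ)

/-- The normalized SVI smile `N(l, ρ)`. -/
def mmN (ρ l : ℝ) : ℝ := Real.sqrt (1 - ρ ^ 2) + ρ * l + Real.sqrt (l ^ 2 + 1)

def mmg (ρ l : ℝ) : ℝ := deriv (mmN ρ) l / 4

def mmh (ρ l : ℝ) : ℝ :=
  1 - (l - ρ / Real.sqrt (1 - ρ ^ 2)) * (deriv (mmN ρ) l / (2 * mmN ρ l))

def mmg₂ (ρ l : ℝ) : ℝ :=
  deriv (deriv (mmN ρ)) l - (deriv (mmN ρ) l) ^ 2 / (2 * mmN ρ l)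

/-- The point `l₂(ρ)`, the reciprocal of a tangent. -/
def mml₂ (ρ : ℝ) : ℝ := (Real.tan (Real.arccos (-ρ) / 3))⁻¹

/-- The Martini-Mingone function; the second argument is the absolute correlation. -/
def fMM (θ ρ : ℝ) : ℝ :=
  ⨅ l : Set.Ioi (mml₂ ρ),
    4 * θ * Real.sqrt (1 - ρ ^ 2) * (mmh ρ l) ^ 2 /
      (θ * Real.sqrt (1 - ρ ^ 2) * (mmg ρ l) ^ 2 - mmg₂ ρ l)

/-! ### The global parametrization

Sequences are indexed by the natural numbers and only the indices `1, …, N` are meaningful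
(`2, …, N` for `a` and `p`). -/

/-- `p_i`, for `2 ≤ i`. -/
def p (ρ : ℕ → ℝ) (i : ℕ) : ℝ :=
  max ((1 + ρ (i - 1)) / (1 + ρ i)) ((1 - ρ (i - 1)) / (1 - ρ i))

/-- `θ_i`, obtained from `θ_1` by `θ_i = θ_{i-1} p_i + a_i` (the value at `0` is not used). -/
def theta (ρ : ℕ → ℝ) (θ₁ : ℝ) (a : ℕ → ℝ) : ℕ → ℝ
  | 0 => 0
  | 1 => θ₁
  | i + 2 => theta ρ θ₁ a (i + 1) * p ρ (i + 2) + a (i + 2)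

/-- `f_i`. -/
def f (𝔣 : ℝ → ℝ → ℝ) (ρ : ℕ → ℝ) (θ₁ : ℝ) (a : ℕ → ℝ) (i : ℕ) : ℝ :=
  min (4 / (1 + |ρ i|)) (Real.sqrt (𝔣 (theta ρ θ₁ a i) |ρ i|))

/-- `min (f_i, f_{i+1} / p_{i+1}, …, f_N / ∏_{j=i+1}^N p_j)`, for `1 ≤ i ≤ N`; the infimum is
over the finite nonempty set `{i, …, N}`. -/
def tailMin (𝔣 : ℝ → ℝ → ℝ) (N : ℕ) (ρ : ℕ → ℝ) (θ₁ : ℝ) (a : ℕ → ℝ) (i : ℕ) : ℝ :=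
  ⨅ m : Set.Icc i N, f 𝔣 ρ θ₁ a m / ∏ j ∈ Finset.Ioc i (m : ℕ), p ρ j

/-- `A_{ψ_i}`, in terms of `ψ_{i-1}` (which is not used for `i = 1`). -/
def Apsi (ρ : ℕ → ℝ) (i : ℕ) (ψprev : ℝ) : ℝ :=
  if i = 1 then 0 else ψprev * p ρ i

/-- `C_{ψ_i}`, in terms of `ψ_{i-1}` (which is not used for `i = 1`). -/
def Cpsi (𝔣 : ℝ → ℝ → ℝ) (N : ℕ) (ρ : ℕ → ℝ) (θ₁ : ℝ) (a : ℕ → ℝ) (i : ℕ) (ψprev : ℝ) : ℝ :=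
  if i = 1 then tailMin 𝔣 N ρ θ₁ a 1
  else min (ψprev / theta ρ θ₁ a (i - 1) * theta ρ θ₁ a i) (tailMin 𝔣 N ρ θ₁ a i)

/-- `ψ_i = c_i (C_{ψ_i} - A_{ψ_i}) + A_{ψ_i}` (the value at `0` is not used). -/
def psi (𝔣 : ℝ → ℝ → ℝ) (N : ℕ) (ρ : ℕ → ℝ) (θ₁ : ℝ) (a c : ℕ → ℝ) : ℕ → ℝ
  | 0 => 0
  | i + 1 =>
    c (i + 1) * (Cpsi 𝔣 N ρ θ₁ a (i + 1) (psi 𝔣 N ρ θ₁ a c i)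
        - Apsi ρ (i + 1) (psi 𝔣 N ρ θ₁ a c i))
      + Apsi ρ (i + 1) (psi 𝔣 N ρ θ₁ a c i)

/-- Call prices, as a function of the strike, of the `i`-th Global eSSVI slice, of maturity
`T i`, for the discount curve `D₀` and the forward curve `F₀`. -/
def callPrice (𝔣 : ℝ → ℝ → ℝ) (N : ℕ) (ρ : ℕ → ℝ) (θ₁ : ℝ) (a c : ℕ → ℝ)
    (T : ℕ → ℝ) (D₀ F₀ : ℝ → ℝ) (i : ℕ) (K : ℝ) : ℝ :=
  ssviCall (D₀ (T i)) (F₀ (T i)) (T i) (theta ρ θ₁ a i) (ρ i) (psi 𝔣 N ρ θ₁ a c i) K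

end

end GlobalESSVI

namespace GlobalESSVI

section

open Real

lemma sin_half_sq_mul_two (γ : ℝ) : 2 * sin (γ / 2) ^ 2 = 1 - cos γ := by
  have := cos_sq (γ / 2)
  have h2 : 2 * (γ / 2) = γ := by ring
  rw [h2] at this
  rw [sin_sq, this]; ring

/-- The Butterfly condition of a normalized SVI smile in angular coordinates. -/
def AngleCond (Θ ψ γ β : ℝ) : Prop :=
  ψ ^ 2 * (Θ * sin ((γ - β) / 2) ^ 2 / 4
      + sin β * sin ((γ - 3 * β) / 2) / sin ((γ + β) / 2)) ≤
    4 * Θ * cos ((γ - β) / 2) ^ 2 / sin γ ^ 2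

variable {Θ ψ γ β : ℝ}

lemma psi_sq_sin_sq_le (hΘ : 0 ≤ Θ) (hψ : 0 ≤ ψ) (hγ : π / 2 ≤ γ) (hγ' : γ < π)
    (hβ : 0 < β) (hβ' : β < π) (hb : ψ * (1 - cos γ) ≤ 4) :
    ψ ^ 2 * (Θ * sin ((γ - β) / 2) ^ 2 / 4) ≤ 4 * Θ * cos ((γ - β) / 2) ^ 2 / sin γ ^ 2 := by
  have hs : 0 < sin (γ / 2) := sin_pos_of_pos_of_lt_pi (by linarith [pi_pos]) (by linarith)
  have hc : 0 < cos (γ / 2) := cos_pos_of_mem_Ioo ⟨by linarith [pi_pos], by linarith⟩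
  have hsγ : sin γ = 2 * sin (γ / 2) * cos (γ / 2) := by
    rw [← sin_two_mul]; congr 1; ring
  have hz : 0 < cos ((γ - β) / 2) :=
    cos_pos_of_mem_Ioo ⟨by linarith [pi_pos], by linarith [pi_pos]⟩
  have h1 : 0 ≤ sin (γ / 2) * cos ((γ - β) / 2) - cos (γ / 2) * sin ((γ - β) / 2) := by
    rw [← sin_sub]
    exact sin_nonneg_of_nonneg_of_le_pi (by linarith) (by linarith)
  have h2 : 0 ≤ sin (γ / 2) * cos ((γ - β) / 2) + cos (γ / 2) * sin ((γ - β) / 2) := by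
    rw [← sin_add]
    exact sin_nonneg_of_nonneg_of_le_pi (by linarith) (by linarith)
  rw [← sin_half_sq_mul_two] at hb
  set S := sin ((γ - β) / 2)
  set C := cos ((γ - β) / 2)
  set s := sin (γ / 2)
  set c := cos (γ / 2)
  have h3 : |c * S| ≤ s * C := abs_le.2 ⟨by linarith, by linarith⟩
  have h4 : (c * S) ^ 2 ≤ (s * C) ^ 2 := by
    rw [← sq_abs (c * S)]; gcongr
  have h5 : (ψ * s ^ 2) ^ 2 ≤ 2 ^ 2 := by
    have : 0 ≤ ψ * s ^ 2 := by positivity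
    gcongr; linarith
  have h6 : (ψ * s ^ 2) ^ 2 * (c * S) ^ 2 ≤ 2 ^ 2 * (s * C) ^ 2 := by gcongr
  have h7 : (ψ * s * c * S) ^ 2 ≤ 4 * C ^ 2 := by
    have : s ^ 2 * (ψ * s * c * S) ^ 2 ≤ s ^ 2 * (4 * C ^ 2) := by linarith
    exact le_of_mul_le_mul_left this (by positivity)
  rw [hsγ, le_div_iff₀ (by positivity)]
  nlinarith [mul_le_mul_of_nonneg_left h7 hΘ]

lemma sin_y_pos (hγ : π / 2 ≤ γ) (hγ' : γ < π) (hβ : 0 < β) (hβ' : β < π) :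
    0 < sin ((γ + β) / 2) :=
  sin_pos_of_pos_of_lt_pi (by linarith [pi_pos]) (by linarith)

lemma angleCond_of_sin_nonpos (hΘ : 0 ≤ Θ) (hψ : 0 ≤ ψ) (hγ : π / 2 ≤ γ) (hγ' : γ < π)
    (hβ : 0 < β) (hβ' : β < π) (hb : ψ * (1 - cos γ) ≤ 4) (hx : sin ((γ - 3 * β) / 2) ≤ 0) :
    AngleCond Θ ψ γ β := by
  have h := psi_sq_sin_sq_le hΘ hψ hγ hγ' hβ hβ' hb
  have hy := sin_y_pos hγ hγ' hβ hβ'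
  have hsβ := sin_pos_of_pos_of_lt_pi hβ hβ'
  have : sin β * sin ((γ - 3 * β) / 2) / sin ((γ + β) / 2) ≤ 0 :=
    div_nonpos_of_nonpos_of_nonneg (mul_nonpos_of_nonneg_of_nonpos hsβ.le hx) hy.le
  unfold AngleCond
  nlinarith [mul_nonneg (sq_nonneg ψ) (neg_nonneg.2 this)]

lemma angleCond_of_reflected (hΘ : 0 ≤ Θ) (hγ : π / 2 ≤ γ) (hγ' : γ < π)
    (hβ : (γ + 2 * π) / 3 < β) (hβ' : β < π) (h : AngleCond Θ ψ γ (π - β)) :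
    AngleCond Θ ψ γ β := by
  have hpi := pi_pos
  have hy := sin_y_pos hγ hγ' (by linarith : 0 < β) hβ'
  have hy' : 0 < sin ((γ + (π - β)) / 2) := sin_y_pos hγ hγ' (by linarith) (by linarith)
  have hsβ : 0 < sin β := sin_pos_of_pos_of_lt_pi (by linarith) hβ'
  have hcos : cos ((γ - (π - β)) / 2) ≤ cos ((γ - β) / 2) := by
    rw [← cos_neg ((γ - β) / 2)]
    exact cos_le_cos_of_nonneg_of_le_pi (by linarith) (by linarith) (by linarith)
  have hcos0 : 0 ≤ cos ((γ - (π - β)) / 2) := cos_nonneg_of_mem_Icc ⟨by linarith, by linarith⟩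
  have hcsq : cos ((γ - (π - β)) / 2) ^ 2 ≤ cos ((γ - β) / 2) ^ 2 := by gcongr
  have hssq : sin ((γ - β) / 2) ^ 2 ≤ sin ((γ - (π - β)) / 2) ^ 2 := by
    rw [sin_sq, sin_sq]; linarith
  have hE : sin β * sin ((γ - 3 * β) / 2) / sin ((γ + β) / 2) ≤
      sin (π - β) * sin ((γ - 3 * (π - β)) / 2) / sin ((γ + (π - β)) / 2) := by
    rw [div_le_div_iff₀ hy hy', sin_pi_sub, mul_assoc, mul_assoc]
    refine mul_le_mul_of_nonneg_left ?_ hsβ.le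
    have hc : cos γ ≤ 0 := cos_nonpos_of_pi_div_two_le_of_le hγ (by linarith)
    have hs : sin (2 * β) ≤ 0 := by
      rw [sin_two_mul]
      have : cos β ≤ 0 := cos_nonpos_of_pi_div_two_le_of_le (by linarith) (by linarith)
      nlinarith
    have key : sin ((γ - 3 * (π - β)) / 2) * sin ((γ + β) / 2)
        - sin ((γ - 3 * β) / 2) * sin ((γ + (π - β)) / 2) = cos γ * sin (2 * β) := by
      have e2 : sin ((γ - 3 * (π - β)) / 2) * sin ((γ + β) / 2) =
          (cos (β - 3 * π / 2) - cos (γ + 2 * β - 3 * π / 2)) / 2 := by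
        rw [cos_sub_cos, show (β - 3 * π / 2 + (γ + 2 * β - 3 * π / 2)) / 2
            = (γ - 3 * (π - β)) / 2 by ring,
          show (β - 3 * π / 2 - (γ + 2 * β - 3 * π / 2)) / 2 = -((γ + β) / 2) by ring, sin_neg]
        ring
      have e3 : sin ((γ - 3 * β) / 2) * sin ((γ + (π - β)) / 2) =
          (cos (β + π / 2) - cos (γ - 2 * β + π / 2)) / 2 := by
        rw [cos_sub_cos, show (β + π / 2 + (γ - 2 * β + π / 2)) / 2
            = (γ + (π - β)) / 2 by ring,
          show (β + π / 2 - (γ - 2 * β + π / 2)) / 2 = -((γ - 3 * β) / 2) by ring, sin_neg]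
        ring
      have e4 : ∀ t, cos (t - 3 * π / 2) = - sin t := fun t => by
        rw [show t - 3 * π / 2 = t + π / 2 - 2 * π by ring, cos_sub_two_pi, cos_add_pi_div_two]
      rw [e2, e3, e4, e4, cos_add_pi_div_two, cos_add_pi_div_two, sin_add, sin_sub]
      ring
    nlinarith [mul_nonneg_of_nonpos_of_nonpos hc hs]
  unfold AngleCond at h ⊢
  refine le_trans ?_ (h.trans ?_) <;> gcongr

lemma angleCond_of_right (hΘ : 0 ≤ Θ) (hψ : 0 ≤ ψ) (hγ : π / 2 ≤ γ) (hγ' : γ < π)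
    (hb : ψ * (1 - cos γ) ≤ 4) (h : ∀ β, 0 < β → β < γ / 3 → AngleCond Θ ψ γ β)
    (hβ : 0 < β) (hβ' : β < π) : AngleCond Θ ψ γ β := by
  rcases lt_or_ge β (γ / 3) with h1 | h1
  · exact h β hβ h1
  rcases lt_or_ge ((γ + 2 * π) / 3) β with h2 | h2
  · exact angleCond_of_reflected hΘ hγ hγ' h2 hβ' (h _ (by linarith) (by linarith))
  · exact angleCond_of_sin_nonpos hΘ hψ hγ hγ' hβ hβ' hb
      (sin_nonpos_of_nonpos_of_neg_pi_le (by linarith) (by linarith))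

lemma angleCond_of_gatheral_jacquier {θ : ℝ} (hθ : 0 ≤ θ) (hψ : 0 ≤ ψ) (hγ : π / 2 ≤ γ)
    (hγ' : γ < π) (hb : ψ * (1 - cos γ) ≤ 4) (hb' : ψ ^ 2 * (1 - cos γ) ≤ 4 * θ)
    (hβ : 0 < β) (hβ' : β < γ / 3) : AngleCond (θ * sin γ) ψ γ β := by
  have hpi := pi_pos
  have hy := sin_y_pos hγ hγ' hβ (by linarith)
  have hs : 0 < sin (γ / 2) := sin_pos_of_pos_of_lt_pi (by linarith) (by linarith)
  have hc : 0 < cos (γ / 2) := cos_pos_of_mem_Ioo ⟨by linarith, by linarith⟩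
  have hsγ : sin γ = 2 * sin (γ / 2) * cos (γ / 2) := by
    rw [← sin_two_mul]; congr 1; ring
  have hsb : 0 < sin (β / 2) := sin_pos_of_pos_of_lt_pi (by linarith) (by linarith)
  have hcb : 0 < cos (β / 2) := cos_pos_of_mem_Ioo ⟨by linarith, by linarith⟩
  have hsβ : sin β = 2 * sin (β / 2) * cos (β / 2) := by
    rw [← sin_two_mul]; congr 1; ring
  have hsγ0 : 0 < sin γ := sin_pos_of_pos_of_lt_pi (by linarith) hγ'
  have hx : 0 < sin ((γ - 3 * β) / 2) := sin_pos_of_pos_of_lt_pi (by linarith) (by linarith)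
  have hcz : 0 < cos ((γ - β) / 2) := cos_pos_of_mem_Ioo ⟨by linarith, by linarith⟩
  have hE0 : 0 ≤ sin β * sin ((γ - 3 * β) / 2) / sin ((γ + β) / 2) := by
    have := sin_pos_of_pos_of_lt_pi hβ (by linarith)
    positivity
  have h1 : sin γ * cos (β / 2) ≤ sin (γ - β / 2) := by
    have : cos γ ≤ 0 := cos_nonpos_of_pi_div_two_le_of_le hγ (by linarith)
    rw [sin_sub]; nlinarith
  have h2 : sin ((γ - 3 * β) / 2) ≤ sin ((γ + β) / 2) := by
    have : 0 ≤ sin ((γ + β) / 2) - sin ((γ - 3 * β) / 2) := by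
      rw [sin_sub_sin, show ((γ + β) / 2 - (γ - 3 * β) / 2) / 2 = β by ring,
        show ((γ + β) / 2 + (γ - 3 * β) / 2) / 2 = (γ - β) / 2 by ring]
      have := sin_pos_of_pos_of_lt_pi hβ (by linarith)
      positivity
    linarith
  have h3 : sin γ * cos (β / 2) * (sin ((γ - 3 * β) / 2) / sin ((γ + β) / 2))
      ≤ sin (γ - β / 2) := by
    refine (mul_le_of_le_one_right (by positivity) ?_).trans h1
    exact (div_le_one hy).2 h2
  have h4 : (sin (γ / 2) * cos ((γ - β) / 2)) ^ 2 - (cos (γ / 2) * sin ((γ - β) / 2)) ^ 2 =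
      sin (β / 2) * sin (γ - β / 2) := by
    rw [show sin (β / 2) = sin (γ / 2 - (γ - β) / 2) by congr 1; ring,
      show sin (γ - β / 2) = sin (γ / 2 + (γ - β) / 2) by congr 1; ring, sin_sub, sin_add]
    ring
  rw [← sin_half_sq_mul_two] at hb hb'
  unfold AngleCond
  set E := sin β * sin ((γ - 3 * β) / 2) / sin ((γ + β) / 2) with hE
  have h5 : sin (γ / 2) * cos (γ / 2) * E ≤ sin (β / 2) * sin (γ - β / 2) := by
    have : sin (γ / 2) * cos (γ / 2) * E = sin (β / 2) *
        (sin γ * cos (β / 2) * (sin ((γ - 3 * β) / 2) / sin ((γ + β) / 2))) := by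
      rw [hE, hsβ, hsγ]; ring
    rw [this]
    exact mul_le_mul_of_nonneg_left h3 hsb.le
  rw [← h4] at h5
  rw [hsγ]
  set S := sin ((γ - β) / 2)
  set C := cos ((γ - β) / 2)
  set s := sin (γ / 2)
  set c := cos (γ / 2)
  have h6 : (ψ * s ^ 2) ^ 2 ≤ 2 ^ 2 := by
    have : 0 ≤ ψ * s ^ 2 := by positivity
    gcongr; linarith
  have h7 : ψ ^ 2 * s ^ 2 ≤ 2 * θ := by linarith
  have h8 : (ψ * s ^ 2) ^ 2 * (θ * s * c ^ 2 * (c * S ^ 2 / 2)) ≤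
      2 ^ 2 * (θ * s * c ^ 2 * (c * S ^ 2 / 2)) := by gcongr
  have h9 : ψ ^ 2 * s ^ 2 * (s ^ 2 * c ^ 2 * E) ≤ 2 * θ * (s ^ 2 * c ^ 2 * E) := by gcongr
  have h10 : 2 * θ * s * c * (s * c * E) ≤ 2 * θ * s * c * ((s * C) ^ 2 - (c * S) ^ 2) := by gcongr
  rw [le_div_iff₀ (by positivity)]
  have h11 : s ^ 2 * (ψ ^ 2 * (θ * (2 * s * c) * S ^ 2 / 4 + E) * (2 * s * c) ^ 2) ≤
      s ^ 2 * (4 * (θ * (2 * s * c)) * C ^ 2) := by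
    linarith
  exact le_of_mul_le_mul_left h11 (by positivity)

end

end GlobalESSVI

namespace GlobalESSVI

section

open Real MeasureTheory ProbabilityTheory Filter Topology Set

noncomputable section

lemma hasDerivAt_Phi (x : ℝ) : HasDerivAt Phi (gaussianPDFReal 0 1 x) x := by
  have hint := integrable_gaussianPDFReal 0 1
  have hcont : Continuous (gaussianPDFReal 0 1) := by
    unfold gaussianPDFReal; fun_prop
  have hPhi : ∀ y, Phi y = ∫ t in Iic y, gaussianPDFReal 0 1 t := by
    intro y
    rw [Phi, cdf_eq_real, measureReal_def, gaussianReal_apply_eq_integral 0 one_ne_zero,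
      ENNReal.toReal_ofReal (integral_nonneg fun t => gaussianPDFReal_nonneg 0 1 t)]
  have heq : Phi = fun y => Phi 0 + ∫ t in (0 : ℝ)..y, gaussianPDFReal 0 1 t := by
    funext y
    rw [hPhi, hPhi, ← intervalIntegral.integral_Iic_sub_Iic hint.integrableOn hint.integrableOn]
    ring
  rw [heq]
  exact (intervalIntegral.integral_hasDerivAt_right (hcont.intervalIntegrable _ _)
    (hcont.stronglyMeasurableAtFilter _ _) hcont.continuousAt).const_add _

lemma Phi_nonneg (x : ℝ) : 0 ≤ Phi x := cdf_nonneg _ x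

lemma Phi_le_one (x : ℝ) : Phi x ≤ 1 := cdf_le_one _ x

lemma hasDerivAt_gaussianPDFReal_zero_one (x : ℝ) :
    HasDerivAt (gaussianPDFReal 0 1) (-x * gaussianPDFReal 0 1 x) x := by
  have h1 : HasDerivAt (fun y : ℝ => -(y - 0) ^ 2 / (2 * ((1 : NNReal) : ℝ))) (-x) x := by
    have := (((hasDerivAt_id x).sub_const 0).pow 2).neg.div_const (2 * ((1 : NNReal) : ℝ))
    refine this.congr_deriv ?_
    simp only [NNReal.coe_one, id]
    push_cast
    ring
  have := (h1.exp).const_mul (√(2 * π * ((1 : NNReal) : ℝ)))⁻¹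
  rw [gaussianPDFReal_def]
  refine this.congr_deriv ?_
  ring

/-- The density identity behind the Black-Scholes formula. -/
lemma gaussianPDFReal_shift (k v : ℝ) (hv : v ≠ 0) :
    exp k * gaussianPDFReal 0 1 (v / 2 - k / v - v) = gaussianPDFReal 0 1 (v / 2 - k / v) := by
  simp only [gaussianPDFReal]
  rw [mul_left_comm, ← exp_add]
  congr 2
  simp only [NNReal.coe_one]
  field_simp
  ring

/-- Normalized Black-Scholes Call price, in terms of the log-forward moneyness `k` and the
square root `v` of the total variance. -/
def normCall (k v : ℝ) : ℝ := Phi (v / 2 - k / v) - exp k * Phi (v / 2 - k / v - v)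

lemma hasDerivAt_normCall {k v : ℝ} (hv : 0 < v) :
    HasDerivAt (normCall k) (gaussianPDFReal 0 1 (v / 2 - k / v)) v := by
  have h1 : HasDerivAt (fun v => v / 2 - k / v) (1 / 2 + k / v ^ 2) v := by
    have := ((hasDerivAt_id v).div_const 2).sub ((hasDerivAt_inv hv.ne').const_mul k)
    refine this.congr_deriv ?_
    field_simp
    ring
  have h2 := h1.sub (hasDerivAt_id v)
  have h3 := ((hasDerivAt_Phi _).comp v h1).sub
    (((hasDerivAt_Phi _).comp v h2).const_mul (exp k))
  refine h3.congr_deriv ?_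
  simp only [id, Pi.sub_apply]
  rw [← mul_assoc, gaussianPDFReal_shift k v hv.ne']
  ring

lemma monotoneOn_normCall (k : ℝ) : MonotoneOn (normCall k) (Ioi 0) := by
  refine monotoneOn_of_deriv_nonneg (convex_Ioi 0)
    (fun v hv => (hasDerivAt_normCall hv).continuousAt.continuousWithinAt) ?_ ?_
  · rw [interior_Ioi]
    exact fun v hv => (hasDerivAt_normCall hv).differentiableAt.differentiableWithinAt
  · rw [interior_Ioi]
    intro v hv
    rw [(hasDerivAt_normCall hv).deriv]
    exact gaussianPDFReal_nonneg _ _ _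

lemma normCall_le_one (k v : ℝ) : normCall k v ≤ 1 := by
  have := mul_nonneg (exp_pos k).le (Phi_nonneg (v / 2 - k / v - v))
  have := Phi_le_one (v / 2 - k / v)
  unfold normCall; linarith

lemma tendsto_normCall (k : ℝ) :
    Tendsto (normCall k) (𝓝[>] 0) (𝓝 (max (1 - exp k) 0)) := by
  have hid : Tendsto (fun v : ℝ => v) (𝓝[>] 0) (𝓝 0) :=
    tendsto_nhdsWithin_of_tendsto_nhds tendsto_id
  have hhalf : Tendsto (fun v : ℝ => v / 2) (𝓝[>] 0) (𝓝 0) := by simpa using hid.div_const 2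
  have hinv : Tendsto (fun v : ℝ => v⁻¹) (𝓝[>] 0) atTop := tendsto_inv_nhdsGT_zero
  rcases lt_trichotomy k 0 with hk | rfl | hk
  · have h1 : Tendsto (fun v : ℝ => v / 2 - k / v) (𝓝[>] 0) atTop := by
      simp only [sub_eq_add_neg, div_eq_mul_inv k, ← neg_mul]
      exact hhalf.add_atTop (hinv.const_mul_atTop (neg_pos.2 hk))
    have h2 : Tendsto (fun v : ℝ => v / 2 - k / v - v) (𝓝[>] 0) atTop := by
      simpa only [sub_eq_add_neg] using h1.atTop_add hid.neg
    have h3 : Tendsto (normCall k) (𝓝[>] 0) (𝓝 (1 - exp k * 1)) :=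
      ((tendsto_cdf_atTop (gaussianReal 0 1)).comp h1).sub
      (((tendsto_cdf_atTop (gaussianReal 0 1)).comp h2).const_mul (exp k))
    rw [max_eq_left (by linarith [exp_le_one_iff.2 hk.le])]
    simpa using h3
  · have hc : Continuous Phi :=
      continuous_iff_continuousAt.2 fun x => (hasDerivAt_Phi x).continuousAt
    have h1 : Tendsto (fun v : ℝ => v / 2 - 0 / v) (𝓝[>] 0) (𝓝 0) := by simpa using hhalf
    have h2 : Tendsto (fun v : ℝ => v / 2 - 0 / v - v) (𝓝[>] 0) (𝓝 0) := by simpa using h1.sub hid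
    have h3 : Tendsto (normCall 0) (𝓝[>] 0) (𝓝 (Phi 0 - exp 0 * Phi 0)) :=
      ((hc.tendsto 0).comp h1).sub (((hc.tendsto 0).comp h2).const_mul (exp 0))
    simpa using h3
  · have h1 : Tendsto (fun v : ℝ => v / 2 - k / v) (𝓝[>] 0) atBot := by
      simp only [sub_eq_add_neg, div_eq_mul_inv k, ← neg_mul]
      exact hhalf.add_atBot (hinv.const_mul_atTop_of_neg (neg_lt_zero.2 hk))
    have h2 : Tendsto (fun v : ℝ => v / 2 - k / v - v) (𝓝[>] 0) atBot := by
      simpa only [sub_eq_add_neg] using h1.atBot_add hid.neg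
    have h3 : Tendsto (normCall k) (𝓝[>] 0) (𝓝 (0 - exp k * 0)) :=
      ((tendsto_cdf_atBot (gaussianReal 0 1)).comp h1).sub
      (((tendsto_cdf_atBot (gaussianReal 0 1)).comp h2).const_mul (exp k))
    rw [max_eq_right (by linarith [one_le_exp hk.le])]
    simpa using h3

lemma le_normCall (k : ℝ) {v : ℝ} (hv : 0 < v) : max (1 - exp k) 0 ≤ normCall k v := by
  refine le_of_tendsto (tendsto_normCall k) ?_
  filter_upwards [Ioo_mem_nhdsGT hv] with u hu
  exact monotoneOn_normCall k hu.1 hv hu.2.le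

/-- Convexity in the strike of the Black-Scholes prices with total variance `w`, under
nonnegativity of Durrleman's function. -/
lemma convexOn_normCall {w w' w'' : ℝ → ℝ} {F : ℝ} (hF : 0 < F) (hw : ∀ k, 0 < w k)
    (hw' : ∀ k, HasDerivAt w (w' k) k) (hw'' : ∀ k, HasDerivAt w' (w'' k) k)
    (hg : ∀ k, 0 ≤ (1 - k * w' k / (2 * w k)) ^ 2 - w' k ^ 2 / 4 * (1 / w k + 1 / 4) + w'' k / 2) :
    ConvexOn ℝ (Ioi 0) fun K => F * normCall (log (K / F)) √(w (log (K / F))) := by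
  set v : ℝ → ℝ := fun k => √(w k) with hv
  have hv0 : ∀ k, 0 < v k := fun k => sqrt_pos.2 (hw k)
  have hvsq : ∀ k, w k = v k ^ 2 := fun k => (sq_sqrt (hw k).le).symm
  have hv' : ∀ k, HasDerivAt v (w' k / (2 * v k)) k := fun k => (hw' k).sqrt (hw k).ne'
  have hv'' : ∀ k, HasDerivAt (fun k => w' k / (2 * v k))
      (w'' k / (2 * v k) - w' k ^ 2 / (4 * v k ^ 3)) k := by
    intro k
    have := (hw'' k).div ((hv' k).const_mul 2) (by have := hv0 k; positivity)
    refine this.congr_deriv ?_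
    have := (hv0 k).ne'
    field_simp
    ring
  have hd1 : ∀ k, HasDerivAt (fun k => v k / 2 - k / v k)
      (w' k / (2 * v k) / 2 - 1 / v k + k * (w' k / (2 * v k)) / v k ^ 2) k := by
    intro k
    have := ((hv' k).div_const 2).sub ((hasDerivAt_id k).div (hv' k) (hv0 k).ne')
    refine this.congr_deriv ?_
    have := (hv0 k).ne'
    simp only [id]
    field_simp
    ring
  have hd2 := fun k => (hd1 k).sub (hv' k)
  set M : ℝ → ℝ := fun k => gaussianPDFReal 0 1 (v k / 2 - k / v k - v k) * (w' k / (2 * v k))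
    - Phi (v k / 2 - k / v k - v k) with hM
  have hMmono : Monotone M := by
    have hMd : ∀ k, HasDerivAt M (gaussianPDFReal 0 1 (v k / 2 - k / v k - v k) / v k *
        ((1 - k * w' k / (2 * w k)) ^ 2 - w' k ^ 2 / 4 * (1 / w k + 1 / 4) + w'' k / 2)) k := by
      intro k
      have := (((hasDerivAt_gaussianPDFReal_zero_one _).comp k (hd2 k)).mul (hv'' k)).sub
        ((hasDerivAt_Phi _).comp k (hd2 k))
      refine this.congr_deriv ?_
      simp only [Function.comp, Pi.sub_apply]
      rw [hvsq k]
      have := (hv0 k).ne'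
      generalize gaussianPDFReal 0 1 (v k / 2 - k / v k - v k) = φ
      field_simp
      ring
    refine monotone_of_deriv_nonneg (fun k => (hMd k).differentiableAt) fun k => ?_
    rw [(hMd k).deriv]
    exact mul_nonneg (div_nonneg (gaussianPDFReal_nonneg _ _ _) (hv0 k).le) (hg k)
  have hC : ∀ k, HasDerivAt (fun k => normCall k (v k)) (exp k * M k) k := by
    intro k
    have := ((hasDerivAt_Phi _).comp k (hd1 k)).sub
      ((hasDerivAt_exp k).mul ((hasDerivAt_Phi _).comp k (hd2 k)))
    refine this.congr_deriv ?_
    simp only [Function.comp, Pi.sub_apply, hM]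
    rw [← gaussianPDFReal_shift k (v k) (hv0 k).ne']
    ring
  have hCK : ∀ K ∈ Ioi (0 : ℝ), HasDerivAt (fun K => F * normCall (log (K / F)) (v (log (K / F))))
      (M (log (K / F))) K := by
    intro K hK
    have hK : 0 < K := hK
    have h1 : HasDerivAt (fun K => log (K / F)) (1 / K) K := by
      have := ((hasDerivAt_id K).div_const F).log (by simp; exact ⟨hK.ne', hF.ne'⟩)
      refine this.congr_deriv ?_
      simp only [id]
      field_simp
    have := ((hC (log (K / F))).comp K h1).const_mul F
    refine this.congr_deriv ?_
    rw [exp_log (by positivity)]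
    field_simp
  refine MonotoneOn.convexOn_of_deriv (convex_Ioi 0)
    (fun K hK => (hCK K hK).continuousAt.continuousWithinAt) ?_ ?_
  · rw [interior_Ioi]
    exact fun K hK => (hCK K hK).differentiableAt.differentiableWithinAt
  · rw [interior_Ioi]
    intro K hK L hL hKL
    rw [(hCK K hK).deriv, (hCK L hL).deriv]
    have hK : 0 < K := hK
    exact hMmono (log_le_log (by positivity) (by gcongr))

end

end

end GlobalESSVI

namespace GlobalESSVI

section

open Real Set

lemma one_sub_sq_pos {ρ : ℝ} (hρ : ρ ∈ Ioo (-1 : ℝ) 1) : 0 < 1 - ρ ^ 2 := by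
  nlinarith [hρ.1, hρ.2]

lemma hasDerivAt_sqrt_sq_add_one (l : ℝ) :
    HasDerivAt (fun l : ℝ => √(l ^ 2 + 1)) (l / √(l ^ 2 + 1)) l := by
  have := ((hasDerivAt_pow 2 l).add_const 1).sqrt (by positivity)
  refine this.congr_deriv ?_
  push_cast
  have : √(l ^ 2 + 1) ≠ 0 := by positivity
  field_simp

lemma deriv_mmN (ρ : ℝ) : deriv (mmN ρ) = fun l => ρ + l / √(l ^ 2 + 1) := by
  funext l
  have := (((hasDerivAt_id l).const_mul ρ).const_add √(1 - ρ ^ 2)).add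
    (hasDerivAt_sqrt_sq_add_one l)
  rw [mul_one] at this
  exact this.deriv

lemma deriv_deriv_mmN (ρ l : ℝ) : deriv (deriv (mmN ρ)) l = 1 / √(l ^ 2 + 1) ^ 3 := by
  have hs : √(l ^ 2 + 1) ≠ 0 := by positivity
  have := ((hasDerivAt_id l).div (hasDerivAt_sqrt_sq_add_one l) hs).const_add ρ
  rw [deriv_mmN]
  refine (this.congr_deriv ?_).deriv
  have h2 : √(l ^ 2 + 1) ^ 2 = l ^ 2 + 1 := sq_sqrt (by positivity)
  simp only [id]
  field_simp
  linarith

lemma mmN_neg_neg (ρ l : ℝ) : mmN (-ρ) (-l) = mmN ρ l := by simp [mmN]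

lemma mmg_neg_neg (ρ l : ℝ) : mmg (-ρ) (-l) = -mmg ρ l := by
  simp only [mmg, deriv_mmN, neg_sq]; ring

lemma mmh_neg_neg (ρ l : ℝ) : mmh (-ρ) (-l) = mmh ρ l := by
  simp only [mmh, deriv_mmN, neg_sq, mmN_neg_neg]; ring

lemma mmg₂_neg_neg (ρ l : ℝ) : mmg₂ (-ρ) (-l) = mmg₂ ρ l := by
  simp only [mmg₂, deriv_deriv_mmN, mmN_neg_neg]
  simp only [deriv_mmN, neg_sq]
  ring

/-- The Butterfly condition of the SSVI slice `(θ, ρ, ψ)` at the normalized abscissa `l`. -/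
def SmileCond (θ ψ ρ l : ℝ) : Prop :=
  ψ ^ 2 * (θ * √(1 - ρ ^ 2) * mmg ρ l ^ 2 - mmg₂ ρ l) ≤ 4 * (θ * √(1 - ρ ^ 2)) * mmh ρ l ^ 2

lemma smileCond_neg_neg {θ ψ ρ l : ℝ} : SmileCond θ ψ (-ρ) (-l) ↔ SmileCond θ ψ ρ l := by
  simp only [SmileCond, mmg_neg_neg, mmh_neg_neg, mmg₂_neg_neg, neg_sq]

section angular

variable {γ β : ℝ}

lemma sqrt_one_sub_neg_cos_sq (hγ : 0 < γ) (hγ' : γ < π) : √(1 - (-cos γ) ^ 2) = sin γ := by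
  rw [neg_sq, ← sin_sq, sqrt_sq (sin_pos_of_pos_of_lt_pi hγ hγ').le]

lemma sqrt_cot_sq_add_one (hβ : 0 < β) (hβ' : β < π) :
    √((cos β / sin β) ^ 2 + 1) = (sin β)⁻¹ := by
  have h := sin_pos_of_pos_of_lt_pi hβ hβ'
  rw [← sqrt_sq (inv_pos.2 h).le]
  congr 1
  field_simp
  rw [add_comm, sin_sq_add_cos_sq]

lemma mmN_angular (hγ : 0 < γ) (hγ' : γ < π) (hβ : 0 < β) (hβ' : β < π) :
    mmN (-cos γ) (cos β / sin β) = 2 * sin ((γ + β) / 2) ^ 2 / sin β := by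
  have h := sin_pos_of_pos_of_lt_pi hβ hβ'
  rw [mmN, sqrt_one_sub_neg_cos_sq hγ hγ', sqrt_cot_sq_add_one hβ hβ', sin_half_sq_mul_two, cos_add]
  field_simp
  ring

lemma deriv_mmN_angular (hβ : 0 < β) (hβ' : β < π) :
    deriv (mmN (-cos γ)) (cos β / sin β) = 2 * sin ((γ + β) / 2) * sin ((γ - β) / 2) := by
  have h := sin_pos_of_pos_of_lt_pi hβ hβ'
  have h2 := cos_sub_cos γ β
  simp only [deriv_mmN]
  rw [sqrt_cot_sq_add_one hβ hβ']
  field_simp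
  linarith

lemma mmg_angular (hβ : 0 < β) (hβ' : β < π) :
    mmg (-cos γ) (cos β / sin β) = sin ((γ + β) / 2) * sin ((γ - β) / 2) / 2 := by
  rw [mmg, deriv_mmN_angular hβ hβ']; ring

lemma mmh_angular (hγ : 0 < γ) (hγ' : γ < π) (hβ : 0 < β) (hβ' : β < π) :
    mmh (-cos γ) (cos β / sin β) = sin ((γ + β) / 2) * cos ((γ - β) / 2) / sin γ := by
  have h := sin_pos_of_pos_of_lt_pi hβ hβ'
  have h' := sin_pos_of_pos_of_lt_pi hγ hγ'
  have hy : 0 < sin ((γ + β) / 2) := sin_pos_of_pos_of_lt_pi (by linarith) (by linarith)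
  have h1 : cos β / sin β - -cos γ / sin γ =
      2 * sin ((γ + β) / 2) * cos ((γ + β) / 2) / (sin β * sin γ) := by
    rw [← sin_two_mul, show 2 * ((γ + β) / 2) = γ + β by ring, sin_add]
    field_simp
    ring
  have h2 : sin γ = sin ((γ + β) / 2) * cos ((γ - β) / 2)
      + cos ((γ + β) / 2) * sin ((γ - β) / 2) := by
    rw [← sin_add]; congr 1; ring
  rw [mmh, sqrt_one_sub_neg_cos_sq hγ hγ', h1, deriv_mmN_angular hβ hβ', mmN_angular hγ hγ' hβ hβ']
  field_simp
  linarith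

lemma mmg₂_angular (hγ : 0 < γ) (hγ' : γ < π) (hβ : 0 < β) (hβ' : β < π) :
    mmg₂ (-cos γ) (cos β / sin β) =
      -(sin ((γ + β) / 2) * sin β * sin ((γ - 3 * β) / 2)) := by
  have h := sin_pos_of_pos_of_lt_pi hβ hβ'
  have hy : 0 < sin ((γ + β) / 2) := sin_pos_of_pos_of_lt_pi (by linarith) (by linarith)
  have h1 : sin ((γ - 3 * β) / 2) * sin ((γ + β) / 2) =
      (sin ((γ - β) / 2) - sin β) * (sin ((γ - β) / 2) + sin β) := by
    rw [show (γ - 3 * β) / 2 = (γ - β) / 2 - β by ring,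
      show (γ + β) / 2 = (γ - β) / 2 + β by ring, sin_sub, sin_add]
    nlinarith [sin_sq_add_cos_sq β, sin_sq_add_cos_sq ((γ - β) / 2)]
  rw [mmg₂, deriv_deriv_mmN, sqrt_cot_sq_add_one hβ hβ', deriv_mmN_angular hβ hβ',
    mmN_angular hγ hγ' hβ hβ']
  generalize sin ((γ - 3 * β) / 2) = X at *
  field_simp
  linarith

lemma smileCond_angular {θ ψ : ℝ} (hγ : 0 < γ) (hγ' : γ < π) (hβ : 0 < β) (hβ' : β < π) :
    SmileCond θ ψ (-cos γ) (cos β / sin β) ↔ AngleCond (θ * sin γ) ψ γ β := by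
  have hy : 0 < sin ((γ + β) / 2) := sin_pos_of_pos_of_lt_pi (by linarith) (by linarith)
  have hs := sin_pos_of_pos_of_lt_pi hγ hγ'
  rw [AngleCond, ← mul_le_mul_iff_right₀ (pow_pos hy 2), SmileCond,
    sqrt_one_sub_neg_cos_sq hγ hγ', mmg_angular hβ hβ', mmh_angular hγ hγ' hβ hβ',
    mmg₂_angular hγ hγ' hβ hβ']
  generalize sin ((γ - 3 * β) / 2) = X
  refine iff_of_eq (congrArg₂ _ ?_ ?_)
  · field_simp
    ring
  · ring

lemma exists_angle (l : ℝ) : ∃ β, 0 < β ∧ β < π ∧ l = cos β / sin β := by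
  refine ⟨π / 2 - arctan l, ?_, ?_, ?_⟩
  · linarith [arctan_lt_pi_div_two l]
  · linarith [neg_pi_div_two_lt_arctan l]
  · rw [cos_pi_div_two_sub, sin_pi_div_two_sub, ← tan_eq_sin_div_cos, tan_arctan]

lemma mml₂_lt_iff (hγ : 0 < γ) (hγ' : γ < π) (hβ : 0 < β) (hβ' : β < π) :
    mml₂ (-cos γ) < cos β / sin β ↔ β < γ / 3 := by
  have ht : arctan (tan (γ / 3)) = γ / 3 := arctan_tan (by linarith) (by linarith)
  have htp : 0 < tan (γ / 3) := tan_pos_of_pos_of_lt_pi_div_two (by linarith) (by linarith)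
  have hcot : arctan (cos β / sin β) = π / 2 - β := by
    rw [← arctan_tan (x := π / 2 - β) (by linarith) (by linarith), tan_eq_sin_div_cos,
      sin_pi_div_two_sub, cos_pi_div_two_sub]
  rw [mml₂, neg_neg, arccos_cos hγ.le hγ'.le, ← arctan_lt_arctan_iff, hcot,
    arctan_inv_of_pos htp, ht]
  constructor <;> intro <;> linarith

end angular

section bounds

variable {θ ψ r : ℝ}

lemma exists_corr_angle (hr : 0 ≤ r) (hr' : r < 1) : ∃ γ, π / 2 ≤ γ ∧ γ < π ∧ r = -cos γ := by
  refine ⟨π - arccos r, ?_, ?_, ?_⟩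
  · linarith [arccos_le_pi_div_two.2 hr]
  · linarith [arccos_pos.2 hr']
  · rw [cos_pi_sub, cos_arccos (by linarith) hr'.le, neg_neg]

lemma smileCond_of_right (hr : 0 ≤ r) (hr' : r < 1) (hθ : 0 ≤ θ) (hψ : 0 ≤ ψ)
    (hb : ψ * (1 + r) ≤ 4) (h : ∀ l, mml₂ r < l → SmileCond θ ψ r l) (l : ℝ) :
    SmileCond θ ψ r l := by
  obtain ⟨γ, hγ, hγ', rfl⟩ := exists_corr_angle hr hr'
  obtain ⟨β, hβ, hβ', rfl⟩ := exists_angle l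
  have hγ0 : 0 < γ := by linarith [pi_pos]
  have hs := sin_pos_of_pos_of_lt_pi hγ0 hγ'
  rw [smileCond_angular hγ0 hγ' hβ hβ']
  refine angleCond_of_right (by positivity) hψ hγ hγ' hb (fun β' h1 h2 => ?_) hβ hβ'
  have h3 : β' < π := by linarith
  rw [← smileCond_angular hγ0 hγ' h1 h3]
  exact h _ ((mml₂_lt_iff hγ0 hγ' h1 h3).2 h2)

lemma smileCond_of_sq_le_fGJ (hr : 0 ≤ r) (hr' : r < 1) (hθ : 0 ≤ θ) (hψ : 0 ≤ ψ)
    (hb : ψ * (1 + r) ≤ 4) (hf : ψ ^ 2 ≤ fGJ θ r) (l : ℝ) (hl : mml₂ r < l) :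
    SmileCond θ ψ r l := by
  rw [fGJ, le_div_iff₀ (by linarith)] at hf
  obtain ⟨γ, hγ, hγ', rfl⟩ := exists_corr_angle hr hr'
  obtain ⟨β, hβ, hβ', rfl⟩ := exists_angle l
  have hγ0 : 0 < γ := by linarith [pi_pos]
  rw [smileCond_angular hγ0 hγ' hβ hβ']
  exact angleCond_of_gatheral_jacquier hθ hψ hγ hγ' hb hf hβ
    ((mml₂_lt_iff hγ0 hγ' hβ hβ').1 hl)

lemma mmg₂_neg_of_mml₂_lt (hr : 0 ≤ r) (hr' : r < 1) (l : ℝ) (hl : mml₂ r < l) :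
    mmg₂ r l < 0 := by
  obtain ⟨γ, hγ, hγ', rfl⟩ := exists_corr_angle hr hr'
  obtain ⟨β, hβ, hβ', rfl⟩ := exists_angle l
  have hγ0 : 0 < γ := by linarith [pi_pos]
  rw [mml₂_lt_iff hγ0 hγ' hβ hβ'] at hl
  rw [mmg₂_angular hγ0 hγ' hβ hβ', neg_lt_zero]
  have h1 := sin_pos_of_pos_of_lt_pi hβ hβ'
  have h2 := sin_y_pos hγ hγ' hβ hβ'
  have h3 : 0 < sin ((γ - 3 * β) / 2) := sin_pos_of_pos_of_lt_pi (by linarith) (by linarith)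
  positivity

lemma mm_denominator_pos (hr : 0 ≤ r) (hr' : r < 1) (hθ : 0 ≤ θ) (l : ℝ) (hl : mml₂ r < l) :
    0 < θ * √(1 - r ^ 2) * mmg r l ^ 2 - mmg₂ r l := by
  have := mmg₂_neg_of_mml₂_lt hr hr' l hl
  have : 0 ≤ θ * √(1 - r ^ 2) * mmg r l ^ 2 := by positivity
  linarith

lemma mm_ratio_nonneg (hr : 0 ≤ r) (hr' : r < 1) (hθ : 0 ≤ θ) (l : Ioi (mml₂ r)) :
    0 ≤ 4 * θ * √(1 - r ^ 2) * mmh r l ^ 2 / (θ * √(1 - r ^ 2) * mmg r l ^ 2 - mmg₂ r l) :=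
  div_nonneg (by positivity) (mm_denominator_pos hr hr' hθ l l.2).le

lemma smileCond_of_sq_le_fMM (hr : 0 ≤ r) (hr' : r < 1) (hθ : 0 ≤ θ) (hf : ψ ^ 2 ≤ fMM θ r)
    (l : ℝ) (hl : mml₂ r < l) : SmileCond θ ψ r l := by
  have h := hf.trans (ciInf_le ⟨0, by
    rintro _ ⟨x, rfl⟩
    exact mm_ratio_nonneg hr hr' hθ x⟩ (⟨l, hl⟩ : Ioi (mml₂ r)))
  rw [le_div_iff₀ (mm_denominator_pos hr hr' hθ l hl)] at h
  rw [SmileCond, ← mul_assoc 4]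
  exact h

lemma bound_nonneg {𝔣 : ℝ → ℝ → ℝ} (h𝔣 : 𝔣 = fGJ ∨ 𝔣 = fMM) (hr : 0 ≤ r) (hr' : r < 1)
    (hθ : 0 ≤ θ) : 0 ≤ 𝔣 θ r := by
  rcases h𝔣 with rfl | rfl
  · unfold fGJ; positivity
  · exact Real.iInf_nonneg fun l => mm_ratio_nonneg hr hr' hθ l

lemma smileCond_of_le_bound {𝔣 : ℝ → ℝ → ℝ} (h𝔣 : 𝔣 = fGJ ∨ 𝔣 = fMM) {ρ : ℝ}
    (hρ : ρ ∈ Ioo (-1 : ℝ) 1) (hθ : 0 ≤ θ) (hψ : 0 ≤ ψ) (hb : ψ ≤ 4 / (1 + |ρ|))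
    (hf : ψ ≤ √(𝔣 θ |ρ|)) (l : ℝ) : SmileCond θ ψ ρ l := by
  have hr' : |ρ| < 1 := abs_lt.2 hρ
  have hr := abs_nonneg ρ
  rw [le_div_iff₀ (by linarith)] at hb
  have hf' : ψ ^ 2 ≤ 𝔣 θ |ρ| := by
    rwa [le_sqrt hψ (bound_nonneg h𝔣 hr hr' hθ)] at hf
  have key : ∀ l, SmileCond θ ψ |ρ| l := by
    refine smileCond_of_right hr hr' hθ hψ hb fun l hl => ?_
    rcases h𝔣 with rfl | rfl
    · exact smileCond_of_sq_le_fGJ hr hr' hθ hψ hb hf' l hl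
    · exact smileCond_of_sq_le_fMM hr hr' hθ hf' l hl
  rcases abs_choice ρ with h | h
  · rw [h] at key; exact key l
  · rw [h] at key; exact smileCond_neg_neg.1 (key (-l))

end bounds

section slice

variable {θ ρ ψ : ℝ}

lemma ssvi_pos (hθ : 0 < θ) (hρ : ρ ∈ Ioo (-1 : ℝ) 1) (k : ℝ) : 0 < ssvi θ ρ ψ k := by
  have hρ' := one_sub_sq_pos hρ
  have : -(θ + ρ * ψ * k) < √((ψ * k + θ * ρ) ^ 2 + θ ^ 2 * (1 - ρ ^ 2)) := by
    rcases eq_or_ne (ψ * k) 0 with h | h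
    · have h' : ρ * ψ * k = 0 := by rw [mul_assoc, h, mul_zero]
      rw [h']
      linarith [sqrt_nonneg ((ψ * k + θ * ρ) ^ 2 + θ ^ 2 * (1 - ρ ^ 2))]
    · refine lt_sqrt_of_sq_lt ?_
      have : 0 < (ψ * k) ^ 2 * (1 - ρ ^ 2) := by positivity
      linarith
  unfold ssvi
  linarith

lemma radicand_pos (hθ : 0 < θ) (hρ : ρ ∈ Ioo (-1 : ℝ) 1) (k : ℝ) :
    0 < (ψ * k + θ * ρ) ^ 2 + θ ^ 2 * (1 - ρ ^ 2) := by
  have hρ' := one_sub_sq_pos hρ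
  positivity

/-- First derivative of the total variance of an SSVI slice. -/
noncomputable def ssviD (θ ρ ψ k : ℝ) : ℝ :=
  ψ / 2 * (ρ + (ψ * k + θ * ρ) / √((ψ * k + θ * ρ) ^ 2 + θ ^ 2 * (1 - ρ ^ 2)))

/-- Second derivative of the total variance of an SSVI slice. -/
noncomputable def ssviDD (θ ρ ψ k : ℝ) : ℝ :=
  ψ ^ 2 / 2 * (θ ^ 2 * (1 - ρ ^ 2) / √((ψ * k + θ * ρ) ^ 2 + θ ^ 2 * (1 - ρ ^ 2)) ^ 3)

lemma hasDerivAt_radical (hθ : 0 < θ) (hρ : ρ ∈ Ioo (-1 : ℝ) 1) (k : ℝ) :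
    HasDerivAt (fun k => √((ψ * k + θ * ρ) ^ 2 + θ ^ 2 * (1 - ρ ^ 2)))
      (ψ * (ψ * k + θ * ρ) / √((ψ * k + θ * ρ) ^ 2 + θ ^ 2 * (1 - ρ ^ 2))) k := by
  have h1 := ((hasDerivAt_id k).const_mul ψ).add_const (θ * ρ)
  have h2 := ((h1.pow 2).add_const (θ ^ 2 * (1 - ρ ^ 2))).sqrt (radicand_pos hθ hρ k).ne'
  refine h2.congr_deriv ?_
  have := (sqrt_pos.2 (radicand_pos (ψ := ψ) hθ hρ k)).ne'
  simp only [id, Pi.pow_apply]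
  push_cast
  field_simp

lemma hasDerivAt_ssvi (hθ : 0 < θ) (hρ : ρ ∈ Ioo (-1 : ℝ) 1) (k : ℝ) :
    HasDerivAt (ssvi θ ρ ψ) (ssviD θ ρ ψ k) k := by
  have h1 := (((hasDerivAt_id k).const_mul (ρ * ψ)).const_add θ).add
    (hasDerivAt_radical (ψ := ψ) hθ hρ k)
  refine (h1.div_const 2).congr_deriv ?_
  rw [ssviD]
  ring

lemma hasDerivAt_ssviD (hθ : 0 < θ) (hρ : ρ ∈ Ioo (-1 : ℝ) 1) (k : ℝ) :
    HasDerivAt (ssviD θ ρ ψ) (ssviDD θ ρ ψ k) k := by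
  have hR := sqrt_pos.2 (radicand_pos (ψ := ψ) hθ hρ k)
  have hR2 := sq_sqrt (radicand_pos (ψ := ψ) hθ hρ k).le
  have h1 := ((hasDerivAt_id k).const_mul ψ).add_const (θ * ρ)
  have h2 := ((h1.div (hasDerivAt_radical (ψ := ψ) hθ hρ k) hR.ne').const_add ρ).const_mul (ψ / 2)
  refine h2.congr_deriv ?_
  rw [ssviDD]
  simp only [id]
  set R := √((ψ * k + θ * ρ) ^ 2 + θ ^ 2 * (1 - ρ ^ 2))
  have hR' := hR.ne'
  field_simp
  rw [hR2]
  ring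

/-- Durrleman's function of an SSVI slice is nonnegative when the normalized condition holds. -/
lemma durrleman_nonneg (hθ : 0 < θ) (hρ : ρ ∈ Ioo (-1 : ℝ) 1)
    (h : ∀ l, SmileCond θ ψ ρ l) (k : ℝ) :
    0 ≤ (1 - k * ssviD θ ρ ψ k / (2 * ssvi θ ρ ψ k)) ^ 2
      - ssviD θ ρ ψ k ^ 2 / 4 * (1 / ssvi θ ρ ψ k + 1 / 4) + ssviDD θ ρ ψ k / 2 := by
  have hw := ssvi_pos (ψ := ψ) hθ hρ k
  have hρ' := one_sub_sq_pos hρ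
  set q := √(1 - ρ ^ 2) with hq
  have hq0 : 0 < q := sqrt_pos.2 hρ'
  have hq2 : q ^ 2 = 1 - ρ ^ 2 := sq_sqrt hρ'.le
  set l := (ψ * k + θ * ρ) / (θ * q) with hl
  set s := √(l ^ 2 + 1) with hs
  have hs0 : 0 < s := sqrt_pos.2 (by positivity)
  have hlk : ψ * k + θ * ρ = θ * q * l := by rw [hl]; field_simp
  have hkψ : k * ψ = θ * q * (l - ρ / q) := by
    rw [mul_sub, ← hlk]; field_simp; ring
  have hR : √((ψ * k + θ * ρ) ^ 2 + θ ^ 2 * (1 - ρ ^ 2)) = θ * q * s := by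
    rw [hlk, ← hq2, hs, ← sqrt_sq (show 0 ≤ θ * q by positivity), ← sqrt_mul (by positivity),
      sqrt_sq (show 0 ≤ θ * q by positivity)]
    congr 1; ring
  set N := mmN ρ l with hN
  set N' := ρ + l / s with hN'
  have hwN : ssvi θ ρ ψ k = θ * q * N / 2 := by
    rw [ssvi, hR, hN, mmN, ← hq, ← hs, mul_assoc ρ ψ k, mul_comm ψ k, hkψ]
    field_simp
    linear_combination -hq2
  have hN0 : 0 < N := by
    rw [hwN] at hw
    have : 0 < θ * q / 2 := by positivity
    exact pos_of_mul_pos_right (a := θ * q / 2) (by linarith) this.le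
  have hw1 : ssviD θ ρ ψ k = ψ / 2 * N' := by
    rw [ssviD, hR, hlk, hN']; field_simp
  have hw2 : ssviDD θ ρ ψ k = ψ ^ 2 / (2 * (θ * q)) * (1 / s ^ 3) := by
    rw [ssviDD, hR, ← hq2]; field_simp
  have hc := h l
  rw [SmileCond, mmg, mmh, mmg₂, deriv_deriv_mmN, deriv_mmN, ← hq, ← hN] at hc
  beta_reduce at hc
  rw [← hs, ← hN'] at hc
  have e1 : k * ssviD θ ρ ψ k / (2 * ssvi θ ρ ψ k) = (l - ρ / q) * (N' / (2 * N)) := by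
    rw [hw1, hwN, show k * (ψ / 2 * N') = k * ψ * N' / 2 by ring, hkψ]; field_simp
  have e2 : ssviD θ ρ ψ k ^ 2 / 4 * (1 / ssvi θ ρ ψ k + 1 / 4) - ssviDD θ ρ ψ k / 2 =
      ψ ^ 2 * (θ * q * (N' / 4) ^ 2 - (1 / s ^ 3 - N' ^ 2 / (2 * N))) / (4 * (θ * q)) := by
    rw [hw1, hw2, hwN]; field_simp; ring
  have e3 : ψ ^ 2 * (θ * q * (N' / 4) ^ 2 - (1 / s ^ 3 - N' ^ 2 / (2 * N))) / (4 * (θ * q)) ≤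
      (1 - (l - ρ / q) * (N' / (2 * N))) ^ 2 := by
    rw [div_le_iff₀ (by positivity), mul_comm _ (4 * (θ * q))]
    exact hc
  rw [e1]
  linarith

lemma ssviCall_eq {D F T K : ℝ} (hF : F ≠ 0) (hT : 0 < T)
    (hw : 0 ≤ ssvi θ ρ ψ (log (K / F))) (hKF : 0 < K / F) :
    ssviCall D F T θ ρ ψ K =
      D * (F * normCall (log (K / F)) √(ssvi θ ρ ψ (log (K / F)))) := by
  have hv : ssviVol F T θ ρ ψ K * √T = √(ssvi θ ρ ψ (log (K / F))) := by
    rw [ssviVol, ← sqrt_mul (by positivity), div_mul_cancel₀ _ hT.ne']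
  simp only [ssviCall, bsCall, hv, normCall]
  rw [exp_log hKF]
  field_simp

lemma noButterflyArbitrage_ssvi {D F T : ℝ} (hD : 0 < D) (hF : 0 < F) (hT : 0 < T)
    (hθ : 0 < θ) (hρ : ρ ∈ Ioo (-1 : ℝ) 1) (h : ∀ l, SmileCond θ ψ ρ l) :
    NoButterflyArbitrage D F (ssviCall D F T θ ρ ψ) := by
  have heq : ∀ K ∈ Ioi (0 : ℝ), D * (F * normCall (log (K / F)) √(ssvi θ ρ ψ (log (K / F)))) =
      ssviCall D F T θ ρ ψ K := fun K hK =>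
    (ssviCall_eq hF.ne' hT (ssvi_pos hθ hρ _).le (div_pos hK hF)).symm
  constructor
  · exact ((convexOn_normCall hF (ssvi_pos hθ hρ) (hasDerivAt_ssvi hθ hρ) (hasDerivAt_ssviD hθ hρ)
      (durrleman_nonneg hθ hρ h)).smul hD.le).congr heq
  · intro K hK
    rw [← heq K hK]
    have h1 := le_normCall (log (K / F)) (sqrt_pos.2 (ssvi_pos (ψ := ψ) hθ hρ (log (K / F))))
    have h2 := normCall_le_one (log (K / F)) √(ssvi θ ρ ψ (log (K / F)))
    rw [exp_log (div_pos hK hF)] at h1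
    constructor
    · refine mul_le_mul_of_nonneg_left ?_ hD.le
      refine le_trans (le_of_eq ?_) (mul_le_mul_of_nonneg_left h1 hF.le)
      rw [mul_max_of_nonneg _ _ hF.le, mul_zero, mul_sub, mul_div_cancel₀ _ hF.ne', mul_one]
    · exact mul_le_mul_of_nonneg_left (mul_le_of_le_one_right hF.le h2) hD.le

lemma noCalendarSpreadArbitrage_ssvi {D₁ F₁ T₁ θ₁ ρ₁ ψ₁ D₂ F₂ T₂ θ₂ ρ₂ ψ₂ : ℝ}
    (hD₁ : 0 < D₁) (hF₁ : 0 < F₁) (hT₁ : 0 < T₁) (hD₂ : 0 < D₂) (hF₂ : 0 < F₂) (hT₂ : 0 < T₂)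
    (hw₁ : ∀ k, 0 < ssvi θ₁ ρ₁ ψ₁ k) (h : ∀ k, ssvi θ₁ ρ₁ ψ₁ k ≤ ssvi θ₂ ρ₂ ψ₂ k) :
    NoCalendarSpreadArbitrage D₁ F₁ (ssviCall D₁ F₁ T₁ θ₁ ρ₁ ψ₁)
      D₂ F₂ (ssviCall D₂ F₂ T₂ θ₂ ρ₂ ψ₂) := by
  have key : ∀ {D F T θ ρ ψ : ℝ}, 0 < D → 0 < F → 0 < T → (∀ k, 0 < ssvi θ ρ ψ k) → ∀ k,
      ssviCall D F T θ ρ ψ (F * exp k) / (D * F) = normCall k √(ssvi θ ρ ψ k) := by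
    intro D F T θ ρ ψ hD hF hT hw k
    have he : F * exp k / F = exp k := by field_simp
    rw [ssviCall_eq hF.ne' hT (hw _).le (by positivity), he, log_exp]
    field_simp
  have hw₂ : ∀ k, 0 < ssvi θ₂ ρ₂ ψ₂ k := fun k => (hw₁ k).trans_le (h k)
  intro k
  rw [key hD₁ hF₁ hT₁ hw₁, key hD₂ hF₂ hT₂ hw₂]
  exact monotoneOn_normCall k (sqrt_pos.2 (hw₁ k)) (sqrt_pos.2 (hw₂ k)) (sqrt_le_sqrt (h k))

end slice

end

end GlobalESSVI

namespace GlobalESSVI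

section

open Real Set

lemma ssvi_neg_neg (θ ρ ψ k : ℝ) : ssvi θ (-ρ) ψ (-k) = ssvi θ ρ ψ k := by
  unfold ssvi; congr 3 <;> ring_nf

section comparison

variable {θ ρ ψ k : ℝ}

/-- The quadratic equation of which the SSVI total variance is the larger root. -/
lemma ssvi_quadratic (hρ : ρ ∈ Ioo (-1 : ℝ) 1) :
    (ssvi θ ρ ψ k - ψ * (1 + ρ) * k / 2) * (ssvi θ ρ ψ k + ψ * (1 - ρ) * k / 2) =
      θ * ssvi θ ρ ψ k := by
  have hρ' := one_sub_sq_pos hρ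
  have h := sq_sqrt (show 0 ≤ (ψ * k + θ * ρ) ^ 2 + θ ^ 2 * (1 - ρ ^ 2) by positivity)
  unfold ssvi
  linear_combination h / 4

lemma lt_ssvi (hθ : 0 < θ) (hρ : ρ ∈ Ioo (-1 : ℝ) 1) (hψk : 0 ≤ ψ * k) :
    ψ * (1 + ρ) * k / 2 < ssvi θ ρ ψ k := by
  have h := ssvi_quadratic (θ := θ) (ψ := ψ) (k := k) hρ
  have hw := ssvi_pos (ψ := ψ) hθ hρ k
  have h1 : 0 ≤ ψ * k * (1 - ρ) := mul_nonneg hψk (by linarith [hρ.2])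
  have h2 : 0 < ssvi θ ρ ψ k + ψ * (1 - ρ) * k / 2 := by linarith
  have h3 : 0 < ssvi θ ρ ψ k - ψ * (1 + ρ) * k / 2 :=
    pos_of_mul_pos_left (by rw [h]; positivity) h2.le
  linarith

lemma ssvi_le_ssvi_of_nonneg {θ' ρ' ψ' : ℝ} (hθ : 0 < θ) (hρ : ρ ∈ Ioo (-1 : ℝ) 1)
    (hρ' : ρ' ∈ Ioo (-1 : ℝ) 1) (hψ : 0 ≤ ψ) (hψ' : 0 ≤ ψ') (hθθ' : θ ≤ θ')
    (hP : ψ * (1 + ρ) ≤ ψ' * (1 + ρ')) (hφ : ψ' ≤ ψ / θ * θ') (hk : 0 ≤ k) :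
    ssvi θ ρ ψ k ≤ ssvi θ' ρ' ψ' k := by
  have hθ' : 0 < θ' := hθ.trans_le hθθ'
  have hw := lt_ssvi hθ hρ (mul_nonneg hψ hk)
  have hw' := lt_ssvi hθ' hρ' (mul_nonneg hψ' hk)
  have hq := ssvi_quadratic (θ := θ) (ψ := ψ) (k := k) hρ
  have hq' := ssvi_quadratic (θ := θ') (ψ := ψ') (k := k) hρ'
  have hw0 := ssvi_pos (ψ := ψ) hθ hρ k
  have hw0' := ssvi_pos (ψ := ψ') hθ' hρ' k
  have hPk : ψ * (1 + ρ) * k / 2 ≤ ψ' * (1 + ρ') * k / 2 := by gcongr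
  have hQ0 : 0 ≤ ψ * (1 - ρ) * k / 2 := by
    have : 0 ≤ 1 - ρ := by linarith [hρ.2]
    positivity
  have hQ0' : 0 ≤ ψ' * (1 - ρ') * k / 2 := by
    have : 0 ≤ 1 - ρ' := by linarith [hρ'.2]
    positivity
  have hP0 : 0 ≤ ψ * (1 + ρ) * k / 2 := by
    have : 0 ≤ 1 + ρ := by linarith [hρ.1]
    positivity
  set lam := θ' / θ with hlam
  have hlam1 : 1 ≤ lam := (one_le_div hθ).2 hθθ'
  have hlamθ : θ' = lam * θ := by rw [hlam]; field_simp
  have hS : ψ' * (1 + ρ') * k / 2 + ψ' * (1 - ρ') * k / 2 ≤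
      lam * (ψ * (1 + ρ) * k / 2 + ψ * (1 - ρ) * k / 2) := by
    have := mul_le_mul_of_nonneg_right hφ hk
    have e : ψ / θ * θ' = lam * ψ := by rw [hlam]; ring
    rw [e] at this
    linarith
  generalize ψ * (1 + ρ) * k / 2 = P at *
  generalize ψ * (1 - ρ) * k / 2 = Q at *
  generalize ψ' * (1 + ρ') * k / 2 = P' at *
  generalize ψ' * (1 - ρ') * k / 2 = Q' at *
  generalize ssvi θ ρ ψ k = w at *
  generalize ssvi θ' ρ' ψ' k = w' at *
  by_contra! hlt
  have hlP : P ≤ lam * P := by nlinarith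
  have hlQ : Q ≤ lam * Q := by nlinarith
  -- the quadratic of the second slice is nonpositive at the first total variance
  have h1 : (w - P') * (w + Q') ≤ θ' * w := by
    calc (w - P') * (w + Q') ≤ (w - P) * (w + lam * (P + Q) - P) := by
          apply mul_le_mul <;> linarith
      _ ≤ (w - P) * (lam * (w + Q)) := by
          apply mul_le_mul_of_nonneg_left _ (by linarith)
          nlinarith
      _ = θ' * w := by rw [hlamθ]; linear_combination lam * hq
  -- while it is increasing to the right of its larger root
  have h2 : θ' * w < (w - P') * (w + Q') := by
    have h3 : w' * (w - P') * (w + Q') - w * ((w' - P') * (w' + Q')) =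
      (w - w') * (w * w' + P' * Q') := by ring
    have h4 : 0 < (w - w') * (w * w' + P' * Q') := by
      have : 0 ≤ P' := hP0.trans hPk
      have : 0 < w - w' := by linarith
      positivity
    have h5 : w' * (θ' * w) < w' * ((w - P') * (w + Q')) := by
      rw [hq'] at h3
      linarith
    exact lt_of_mul_lt_mul_left h5 hw0'.le
  linarith

lemma ssvi_le_ssvi {θ' ρ' ψ' : ℝ} (hθ : 0 < θ) (hρ : ρ ∈ Ioo (-1 : ℝ) 1)
    (hρ' : ρ' ∈ Ioo (-1 : ℝ) 1) (hψ : 0 ≤ ψ) (hψ' : 0 ≤ ψ') (hθθ' : θ ≤ θ')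
    (hP : ψ * (1 + ρ) ≤ ψ' * (1 + ρ')) (hQ : ψ * (1 - ρ) ≤ ψ' * (1 - ρ'))
    (hφ : ψ' ≤ ψ / θ * θ') (k : ℝ) : ssvi θ ρ ψ k ≤ ssvi θ' ρ' ψ' k := by
  rcases le_total 0 k with hk | hk
  · exact ssvi_le_ssvi_of_nonneg hθ hρ hρ' hψ hψ' hθθ' hP hφ hk
  · rw [← ssvi_neg_neg, ← ssvi_neg_neg θ']
    refine ssvi_le_ssvi_of_nonneg hθ ?_ ?_ hψ hψ' hθθ' ?_ hφ (by linarith)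
    · exact ⟨by linarith [hρ.2], by linarith [hρ.1]⟩
    · exact ⟨by linarith [hρ'.2], by linarith [hρ'.1]⟩
    · simpa [sub_eq_add_neg] using hQ

end comparison

section parameters

variable {𝔣 : ℝ → ℝ → ℝ} {N : ℕ} {ρ : ℕ → ℝ} {θ₁ : ℝ} {a c : ℕ → ℝ}

lemma p_pos (hρ : ∀ i ∈ Finset.Icc 1 N, ρ i ∈ Ioo (-1 : ℝ) 1) {i : ℕ} (hi : 1 ≤ i)
    (hiN : i + 1 ≤ N) : 0 < p ρ (i + 1) := by
  have h1 := hρ i (Finset.mem_Icc.2 ⟨hi, by omega⟩)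
  have h2 := hρ (i + 1) (Finset.mem_Icc.2 ⟨by omega, hiN⟩)
  exact lt_max_of_lt_left (div_pos (by simpa using by linarith [h1.1]) (by linarith [h2.1]))

lemma one_le_p (hρ : ∀ i ∈ Finset.Icc 1 N, ρ i ∈ Ioo (-1 : ℝ) 1) {i : ℕ} (hi : 1 ≤ i)
    (hiN : i + 1 ≤ N) : 1 ≤ p ρ (i + 1) := by
  have h2 := hρ (i + 1) (Finset.mem_Icc.2 ⟨by omega, hiN⟩)
  rcases le_total (ρ (i + 1)) (ρ i) with h | h
  · refine le_max_of_le_left ((one_le_div (by linarith [h2.1])).2 ?_)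
    simpa using h
  · refine le_max_of_le_right ((one_le_div (by linarith [h2.2])).2 ?_)
    simpa only [Nat.add_sub_cancel] using sub_le_sub_left h 1

lemma one_add_le_p_mul (hρ : ∀ i ∈ Finset.Icc 1 N, ρ i ∈ Ioo (-1 : ℝ) 1) {i : ℕ}
    (hiN : i + 1 ≤ N) : 1 + ρ i ≤ p ρ (i + 1) * (1 + ρ (i + 1)) := by
  have h2 := hρ (i + 1) (Finset.mem_Icc.2 ⟨by omega, hiN⟩)
  rw [← div_le_iff₀ (by linarith [h2.1])]
  exact le_max_left _ _

lemma one_sub_le_p_mul (hρ : ∀ i ∈ Finset.Icc 1 N, ρ i ∈ Ioo (-1 : ℝ) 1) {i : ℕ}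
    (hiN : i + 1 ≤ N) : 1 - ρ i ≤ p ρ (i + 1) * (1 - ρ (i + 1)) := by
  have h2 := hρ (i + 1) (Finset.mem_Icc.2 ⟨by omega, hiN⟩)
  rw [← div_le_iff₀ (by linarith [h2.2])]
  exact le_max_right _ _

lemma theta_succ {i : ℕ} (hi : 1 ≤ i) :
    theta ρ θ₁ a (i + 1) = theta ρ θ₁ a i * p ρ (i + 1) + a (i + 1) := by
  obtain ⟨j, rfl⟩ := Nat.exists_eq_add_of_le' hi
  rfl

lemma theta_pos (hρ : ∀ i ∈ Finset.Icc 1 N, ρ i ∈ Ioo (-1 : ℝ) 1) (hθ₁ : 0 < θ₁)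
    (ha : ∀ i ∈ Finset.Icc 2 N, 0 < a i) {i : ℕ} (hi : 1 ≤ i) (hiN : i ≤ N) :
    0 < theta ρ θ₁ a i := by
  induction i, hi using Nat.le_induction with
  | base => exact hθ₁
  | succ i hi ih =>
    rw [theta_succ hi]
    have := ih (by omega)
    have := p_pos hρ hi hiN
    have := ha (i + 1) (Finset.mem_Icc.2 ⟨by omega, hiN⟩)
    positivity

lemma theta_mul_p_le (ha : ∀ i ∈ Finset.Icc 2 N, 0 < a i) {i : ℕ} (hi : 1 ≤ i)
    (hiN : i + 1 ≤ N) : theta ρ θ₁ a i * p ρ (i + 1) ≤ theta ρ θ₁ a (i + 1) := by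
  rw [theta_succ hi]
  linarith [ha (i + 1) (Finset.mem_Icc.2 ⟨by omega, hiN⟩)]

lemma prod_p_pos (hρ : ∀ i ∈ Finset.Icc 1 N, ρ i ∈ Ioo (-1 : ℝ) 1) {i m : ℕ} (hi : 1 ≤ i)
    (hm : m ≤ N) : 0 < ∏ j ∈ Finset.Ioc i m, p ρ j := by
  refine Finset.prod_pos fun j hj => ?_
  rw [Finset.mem_Ioc] at hj
  obtain ⟨j, rfl⟩ := Nat.exists_eq_add_of_le' (show 1 ≤ j by omega)
  exact p_pos hρ (by omega) (by omega)

lemma f_nonneg (i : ℕ) : 0 ≤ f 𝔣 ρ θ₁ a i := by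
  unfold f; positivity

lemma tailMin_le {i m : ℕ} (him : i ≤ m) (hmN : m ≤ N) :
    tailMin 𝔣 N ρ θ₁ a i ≤ f 𝔣 ρ θ₁ a m / ∏ j ∈ Finset.Ioc i m, p ρ j :=
  ciInf_le (Set.finite_range _).bddBelow (⟨m, him, hmN⟩ : Icc i N)

lemma tailMin_le_f {i : ℕ} (hiN : i ≤ N) : tailMin 𝔣 N ρ θ₁ a i ≤ f 𝔣 ρ θ₁ a i := by
  simpa using tailMin_le (𝔣 := 𝔣) (ρ := ρ) (θ₁ := θ₁) (a := a) le_rfl hiN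

lemma tailMin_nonneg (hρ : ∀ i ∈ Finset.Icc 1 N, ρ i ∈ Ioo (-1 : ℝ) 1) {i : ℕ} (hi : 1 ≤ i) :
    0 ≤ tailMin 𝔣 N ρ θ₁ a i :=
  Real.iInf_nonneg fun m => div_nonneg (f_nonneg _) (prod_p_pos hρ hi m.2.2).le

lemma tailMin_mul_p_le (hρ : ∀ i ∈ Finset.Icc 1 N, ρ i ∈ Ioo (-1 : ℝ) 1) {i : ℕ} (hi : 1 ≤ i)
    (hiN : i + 1 ≤ N) : tailMin 𝔣 N ρ θ₁ a i * p ρ (i + 1) ≤ tailMin 𝔣 N ρ θ₁ a (i + 1) := by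
  have : Nonempty (Icc (i + 1) N) := ⟨⟨i + 1, le_rfl, hiN⟩⟩
  refine le_ciInf fun m => ?_
  have hm1 : i + 1 ≤ m := m.2.1
  have hp := p_pos hρ hi hiN
  have hprod := prod_p_pos hρ (show 1 ≤ i + 1 by omega) m.2.2
  have h := tailMin_le (𝔣 := 𝔣) (ρ := ρ) (θ₁ := θ₁) (a := a) (show i ≤ m by omega) m.2.2
  have hsplit : ∏ j ∈ Finset.Ioc i (m : ℕ), p ρ j =
      p ρ (i + 1) * ∏ j ∈ Finset.Ioc (i + 1) (m : ℕ), p ρ j := by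
    rw [← Finset.prod_Ioc_consecutive _ (Nat.le_succ i) hm1]
    simp
  rw [hsplit, le_div_iff₀ (by positivity)] at h
  rw [le_div_iff₀ hprod]
  linarith

lemma psi_one : psi 𝔣 N ρ θ₁ a c 1 = c 1 * tailMin 𝔣 N ρ θ₁ a 1 := by
  simp [psi, Cpsi, Apsi]

lemma psi_succ {i : ℕ} (hi : 1 ≤ i) :
    psi 𝔣 N ρ θ₁ a c (i + 1) =
      c (i + 1) * (min (psi 𝔣 N ρ θ₁ a c i / theta ρ θ₁ a i * theta ρ θ₁ a (i + 1))
          (tailMin 𝔣 N ρ θ₁ a (i + 1)) - psi 𝔣 N ρ θ₁ a c i * p ρ (i + 1))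
        + psi 𝔣 N ρ θ₁ a c i * p ρ (i + 1) := by
  have : i ≠ 0 := by omega
  simp [psi, Cpsi, Apsi, this]

lemma convex_comb_mem {t A C : ℝ} (ht : t ∈ Ioo (0 : ℝ) 1) (h : A ≤ C) :
    A ≤ t * (C - A) + A ∧ t * (C - A) + A ≤ C :=
  ⟨by nlinarith [ht.1], by nlinarith [ht.2]⟩

variable (hρ : ∀ i ∈ Finset.Icc 1 N, ρ i ∈ Ioo (-1 : ℝ) 1) (hθ₁ : 0 < θ₁)
  (ha : ∀ i ∈ Finset.Icc 2 N, 0 < a i) (hc : ∀ i ∈ Finset.Icc 1 N, c i ∈ Ioo (0 : ℝ) 1)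

include hρ hθ₁ ha hc

lemma psi_step {i : ℕ} (hi : 1 ≤ i) (hiN : i + 1 ≤ N) (h0 : 0 ≤ psi 𝔣 N ρ θ₁ a c i)
    (h1 : psi 𝔣 N ρ θ₁ a c i ≤ tailMin 𝔣 N ρ θ₁ a i) :
    psi 𝔣 N ρ θ₁ a c i * p ρ (i + 1) ≤ psi 𝔣 N ρ θ₁ a c (i + 1) ∧
    psi 𝔣 N ρ θ₁ a c (i + 1) ≤ psi 𝔣 N ρ θ₁ a c i / theta ρ θ₁ a i * theta ρ θ₁ a (i + 1) ∧
    psi 𝔣 N ρ θ₁ a c (i + 1) ≤ tailMin 𝔣 N ρ θ₁ a (i + 1) := by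
  have hp := p_pos hρ hi hiN
  have hθ := theta_pos hρ hθ₁ ha hi (by omega : i ≤ N)
  have hAC : psi 𝔣 N ρ θ₁ a c i * p ρ (i + 1) ≤
      min (psi 𝔣 N ρ θ₁ a c i / theta ρ θ₁ a i * theta ρ θ₁ a (i + 1))
        (tailMin 𝔣 N ρ θ₁ a (i + 1)) := by
    refine le_min ?_ ?_
    · rw [div_mul_eq_mul_div, le_div_iff₀ hθ, mul_assoc, mul_comm (p ρ (i + 1))]
      exact mul_le_mul_of_nonneg_left (theta_mul_p_le ha hi hiN) h0
    · exact (mul_le_mul_of_nonneg_right h1 hp.le).trans (tailMin_mul_p_le hρ hi hiN)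
  have h := convex_comb_mem (hc (i + 1) (Finset.mem_Icc.2 ⟨by omega, hiN⟩)) hAC
  rw [← psi_succ hi] at h
  exact ⟨h.1, h.2.trans (min_le_left _ _), h.2.trans (min_le_right _ _)⟩

lemma psi_mem {i : ℕ} (hi : 1 ≤ i) (hiN : i ≤ N) :
    0 ≤ psi 𝔣 N ρ θ₁ a c i ∧ psi 𝔣 N ρ θ₁ a c i ≤ tailMin 𝔣 N ρ θ₁ a i := by
  induction i, hi using Nat.le_induction with
  | base =>
    have h := hc 1 (Finset.mem_Icc.2 ⟨le_rfl, hiN⟩)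
    have h0 := tailMin_nonneg (𝔣 := 𝔣) (θ₁ := θ₁) (a := a) hρ (le_refl 1)
    rw [psi_one]
    exact ⟨mul_nonneg h.1.le h0, mul_le_of_le_one_left h0 h.2.le⟩
  | succ i hi ih =>
    obtain ⟨h0, h1⟩ := ih (by omega)
    obtain ⟨h2, -, h3⟩ := psi_step hρ hθ₁ ha hc hi hiN h0 h1
    exact ⟨(mul_nonneg h0 (p_pos hρ hi hiN).le).trans h2, h3⟩

lemma ssvi_succ_le {i : ℕ} (hi : 1 ≤ i) (hiN : i + 1 ≤ N) (k : ℝ) :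
    ssvi (theta ρ θ₁ a i) (ρ i) (psi 𝔣 N ρ θ₁ a c i) k ≤
      ssvi (theta ρ θ₁ a (i + 1)) (ρ (i + 1)) (psi 𝔣 N ρ θ₁ a c (i + 1)) k := by
  have h2 := hρ (i + 1) (Finset.mem_Icc.2 ⟨by omega, hiN⟩)
  have hθ := theta_pos hρ hθ₁ ha hi (by omega : i ≤ N)
  obtain ⟨h0, h1⟩ := psi_mem (𝔣 := 𝔣) hρ hθ₁ ha hc hi (by omega)
  obtain ⟨hA, hφ, -⟩ := psi_step hρ hθ₁ ha hc hi hiN h0 h1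
  refine ssvi_le_ssvi hθ (hρ i (Finset.mem_Icc.2 ⟨hi, by omega⟩)) h2 h0
    (psi_mem hρ hθ₁ ha hc (by omega) hiN).1 ?_ ?_ ?_ hφ k
  · exact (le_mul_of_one_le_right hθ.le (one_le_p hρ hi hiN)).trans (theta_mul_p_le ha hi hiN)
  · refine (mul_le_mul_of_nonneg_left (one_add_le_p_mul hρ hiN) h0).trans ?_
    rw [← mul_assoc]
    exact mul_le_mul_of_nonneg_right hA (by linarith [h2.1])
  · refine (mul_le_mul_of_nonneg_left (one_sub_le_p_mul hρ hiN) h0).trans ?_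
    rw [← mul_assoc]
    exact mul_le_mul_of_nonneg_right hA (by linarith [h2.2])

lemma ssvi_le_of_le {i j : ℕ} (hi : 1 ≤ i) (hij : i ≤ j) (hjN : j ≤ N) (k : ℝ) :
    ssvi (theta ρ θ₁ a i) (ρ i) (psi 𝔣 N ρ θ₁ a c i) k ≤
      ssvi (theta ρ θ₁ a j) (ρ j) (psi 𝔣 N ρ θ₁ a c j) k := by
  induction j, hij using Nat.le_induction with
  | base => exact le_rfl
  | succ j hij ih =>
    exact (ih (by omega)).trans (ssvi_succ_le hρ hθ₁ ha hc (by omega) hjN k)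

end parameters

end

end GlobalESSVI

theorem mainTheorem1
    (𝔣 : ℝ → ℝ → ℝ) (h𝔣 : 𝔣 = GlobalESSVI.fGJ ∨ 𝔣 = GlobalESSVI.fMM)
    (N : ℕ) (hN : 0 < N)
    (ρ : ℕ → ℝ) (hρ : ∀ i ∈ Finset.Icc 1 N, ρ i ∈ Set.Ioo (-1 : ℝ) 1)
    (θ₁ : ℝ) (hθ₁ : 0 < θ₁)
    (a : ℕ → ℝ) (ha : ∀ i ∈ Finset.Icc 2 N, 0 < a i)
    (c : ℕ → ℝ) (hc : ∀ i ∈ Finset.Icc 1 N, c i ∈ Set.Ioo (0 : ℝ) 1)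
    (T : ℕ → ℝ) (hT : ∀ i ∈ Finset.Icc 1 N, 0 < T i)
    (hT_mono : ∀ i ∈ Finset.Icc 1 N, ∀ j ∈ Finset.Icc 1 N, i < j → T i < T j)
    (D₀ F₀ : ℝ → ℝ)
    (hD₀ : ∀ i ∈ Finset.Icc 1 N, 0 < D₀ (T i)) (hF₀ : ∀ i ∈ Finset.Icc 1 N, 0 < F₀ (T i)) :
    (∀ i ∈ Finset.Icc 1 N,
      GlobalESSVI.NoButterflyArbitrage (D₀ (T i)) (F₀ (T i))
        (GlobalESSVI.callPrice 𝔣 N ρ θ₁ a c T D₀ F₀ i)) ∧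
    (∀ i ∈ Finset.Icc 1 N, ∀ j ∈ Finset.Icc 1 N, i < j →
      GlobalESSVI.NoCalendarSpreadArbitrage
        (D₀ (T i)) (F₀ (T i)) (GlobalESSVI.callPrice 𝔣 N ρ θ₁ a c T D₀ F₀ i)
        (D₀ (T j)) (F₀ (T j)) (GlobalESSVI.callPrice 𝔣 N ρ θ₁ a c T D₀ F₀ j)) := by
  have hθ : ∀ i ∈ Finset.Icc 1 N, 0 < GlobalESSVI.theta ρ θ₁ a i := fun i hi =>
    GlobalESSVI.theta_pos hρ hθ₁ ha (Finset.mem_Icc.1 hi).1 (Finset.mem_Icc.1 hi).2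
  constructor
  · intro i hi
    obtain ⟨hi1, hiN⟩ := Finset.mem_Icc.1 hi
    obtain ⟨h0, h1⟩ := GlobalESSVI.psi_mem (𝔣 := 𝔣) hρ hθ₁ ha hc hi1 hiN
    have hf := h1.trans (GlobalESSVI.tailMin_le_f hiN)
    exact GlobalESSVI.noButterflyArbitrage_ssvi (hD₀ i hi) (hF₀ i hi) (hT i hi) (hθ i hi) (hρ i hi)
      (GlobalESSVI.smileCond_of_le_bound h𝔣 (hρ i hi) (hθ i hi).le h0
        (hf.trans (min_le_left _ _)) (hf.trans (min_le_right _ _)))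
  · intro i hi j hj hij
    exact GlobalESSVI.noCalendarSpreadArbitrage_ssvi (hD₀ i hi) (hF₀ i hi) (hT i hi)
      (hD₀ j hj) (hF₀ j hj) (hT j hj) (GlobalESSVI.ssvi_pos (hθ i hi) (hρ i hi))
      (GlobalESSVI.ssvi_le_of_le hρ hθ₁ ha hc (Finset.mem_Icc.1 hi).1 hij.le
        (Finset.mem_Icc.1 hj).2)
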